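/- Let $N\ge 1$, let $\mathbb P=[p_{ij}]\in\mathbb R^{N\times N}$ be a transition probability matrix (nonnegative entries, rows summing to $1$), and let $M_1,\dots,M_N\in\mathbb R^{d\times d}$. For $\sigma_0\in\{1,\dots,N\}$ let $\{\sigma_k\}_{k\ge 0}$ be a time-homogeneous Markov chain on $\{1,\dots,N\}$ with transition matrix $\mathbb P$ and constant initial state $\sigma_0$, and put $A_k=M_{\sigma_k}$. For a positive integer $p$ and a norm $\|\cdot\|$ on $\mathbb R^{d\times d}$, the $p$-radius ($L^p$-norm joint spectral radius) of the process $A=\{A_k\}$ is $$\rho_{p,A}=\rho_{p,A}(\sigma_0)=\lim_{k\to\infty}\bigl(E[\|A_k\cdots A_1\|^p]\bigr)^{1/(pk)} .$$ Let $M^{\otimes p}$ be the $p$-th Kronecker power, $\rho(\cdot)$ the spectral radius of a matrix, and $$T_p=(\mathbb P^\top\otimes I_{d^p})\,\mathrm{diag}(M_1^{\otimes p},\dots,M_N^{\otimes p})\in\mathbb R^{Nd^p\times Nd^p}.$$ Assume that either $p=2$, or $p=1$ and there is a proper cone $K\subset\mathbb R^d$ (closed under multiplication by nonnegative scalars, closed,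 convex, with nonempty interior, and such that $x,-x\in K$ implies $x=0$) with $M_iK\subset K$ for all $i$. Then, for every norm, the limit defining $\rho_{p,A}(\sigma_0)$ exists for every $\sigma_0$, and $$\max_{\sigma_0\in\{1,\dots,N\}}\rho_{p,A}(\sigma_0)=\rho(T_p)^{1/p}.$$ Moreover, if all $p_{ij}$ are positive, or if $\mathbb P$ is irreducible (for all $i,j$ there is $n\ge 0$ with $(\mathbb P^n)_{ij}>0$) and every $M_i$ is invertible, then $\rho_{p,A}(\sigma_0)=\rho(T_p)^{1/p}$ for every initial state $\sigma_0$. -/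

import Mathlib

open scoped Topology Kronecker
open Filter MeasureTheory

namespace MarkovSwitched

/-- A proper cone of `ℝ^d`: closed under multiplication by nonnegative scalars, closed, convex,
solid (nonempty interior) and pointed. -/
structure IsProperCone {d : ℕ} (K : Set (Fin d → ℝ)) : Prop where
  smul_mem : ∀ c : ℝ, 0 ≤ c → ∀ x ∈ K, c • x ∈ K
  isClosed : IsClosed K
  convex : Convex ℝ K
  solid : (interior K).Nonempty
  pointed : ∀ x, x ∈ K → -x ∈ K → x = 0

/-- The matrix `M` maps the set `K` into itself. -/
def LeavesInvariant {d : ℕ} (M : Matrix (Fin d) (Fin d) ℝ) (K : Set (Fin d → ℝ)) : Prop :=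
  ∀ x ∈ K, M.mulVec x ∈ K

/-- The `p`-th Kronecker power of a `d × d` matrix, a matrix of size `d^p × d^p` whose rows and
columns are indexed by the multi-indices `(i_1, …, i_p)`. -/
def kronPow {d : ℕ} (M : Matrix (Fin d) (Fin d) ℝ) (p : ℕ) :
    Matrix (Fin p → Fin d) (Fin p → Fin d) ℝ :=
  Matrix.of fun i j => ∏ l, M (i l) (j l)

theorem kronPow_one_apply {d : ℕ} (M : Matrix (Fin d) (Fin d) ℝ) (i j : Fin 1 → Fin d) :
    kronPow M 1 i j = M (i 0) (j 0) := by
  simp [kronPow]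

/-- The recursion `M^{⊗(p+1)} = M^{⊗p} ⊗ M`, up to the identification of index sets. -/
theorem kronPow_succ {d : ℕ} (M : Matrix (Fin d) (Fin d) ℝ) (p : ℕ) :
    kronPow M (p + 1) =
      (kronPow M p ⊗ₖ M).submatrix (fun i => (Fin.init i, i (Fin.last p)))
        (fun i => (Fin.init i, i (Fin.last p))) := by
  ext i j
  simp [kronPow, Fin.prod_univ_castSucc, Fin.init]

/-- The matrix `T_p = (Pᵀ ⊗ I) diag(M_1^{⊗p}, …, M_N^{⊗p})` of size `N d^p × N d^p`. -/
def transferMatrix {N d : ℕ} (P : Matrix (Fin N) (Fin N) ℝ)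
    (M : Fin N → Matrix (Fin d) (Fin d) ℝ) (p : ℕ) :
    Matrix (Fin N × (Fin p → Fin d)) (Fin N × (Fin p → Fin d)) ℝ :=
  (P.transpose ⊗ₖ (1 : Matrix (Fin p → Fin d) (Fin p → Fin d) ℝ)) *
    (Matrix.blockDiagonal fun i => kronPow (M i) p).submatrix Prod.swap Prod.swap

/-- Entries of `T_p`: its `(j, i)` block is `p_{ij} M_i^{⊗p}`. -/
theorem transferMatrix_apply {N d : ℕ} (P : Matrix (Fin N) (Fin N) ℝ)
    (M : Fin N → Matrix (Fin d) (Fin d) ℝ) (p : ℕ) (j i : Fin N) (a b : Fin p → Fin d) :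
    transferMatrix P M p (j, a) (i, b) = P i j * kronPow (M i) p a b := by
  simp [transferMatrix, Matrix.mul_apply, Fintype.sum_prod_type, Matrix.blockDiagonal_apply,
    Matrix.one_apply]

/-- The spectral radius of a real square matrix: the largest modulus of a complex eigenvalue. -/
noncomputable def specRadius {n : Type*} [Fintype n] [DecidableEq n] (T : Matrix n n ℝ) : ℝ :=
  (spectralRadius ℂ (T.map (algebraMap ℝ ℂ))).toReal

/-- `σ` is a time-homogeneous Markov chain with state space `Fin N`, transition probability
matrix `P` and constant initial state `s₀` on the probability space `(Ω, μ)`. -/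
structure IsMarkovChain {N : ℕ} (P : Matrix (Fin N) (Fin N) ℝ) (s₀ : Fin N)
    {Ω : Type*} [MeasurableSpace Ω] (μ : Measure Ω) (σ : ℕ → Ω → Fin N) : Prop where
  measurable : ∀ k, Measurable (σ k)
  initial : ∀ᵐ ω ∂μ, σ 0 ω = s₀
  transition : ∀ (k : ℕ) (s : ℕ → Fin N),
    μ.real {ω | ∀ n ≤ k + 1, σ n ω = s n} =
      μ.real {ω | ∀ n ≤ k, σ n ω = s n} * P (s k) (s (k + 1))

/-- The product `A_k ⋯ A_1` (empty for `k = 0`). -/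
def revProd {d : ℕ} {Ω : Type*} (A : ℕ → Ω → Matrix (Fin d) (Fin d) ℝ) :
    ℕ → Ω → Matrix (Fin d) (Fin d) ℝ
  | 0, _ => 1
  | k + 1, ω => A (k + 1) ω * revProd A k ω

/-- The sequence `k ↦ (E[‖A_k ⋯ A_1‖^p])^{1/(pk)}`, for the norm `ν` on `d × d` matrices. -/
noncomputable def pRadiusSeq {d : ℕ} (ν : Matrix (Fin d) (Fin d) ℝ → ℝ) (p : ℕ)
    {Ω : Type*} [MeasurableSpace Ω] (μ : Measure Ω)
    (A : ℕ → Ω → Matrix (Fin d) (Fin d) ℝ) (k : ℕ) : ℝ :=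
  (∫ ω, ν (revProd A k ω) ^ p ∂μ) ^ (1 / ((p : ℝ) * (k : ℝ)))

/-- The `L^p`-norm joint spectral radius of the process `A`: the limit of `pRadiusSeq`
(meaningful when that sequence converges). -/
noncomputable def pRadius {d : ℕ} (ν : Matrix (Fin d) (Fin d) ℝ → ℝ) (p : ℕ)
    {Ω : Type*} [MeasurableSpace Ω] (μ : Measure Ω)
    (A : ℕ → Ω → Matrix (Fin d) (Fin d) ℝ) : ℝ :=
  limUnder atTop (pRadiusSeq ν p μ A)

end MarkovSwitched

/-! For the chain started at s, E[1_{σ_k=j} (A_k⋯A_1)^{⊗p}] is the (j, s) block of T'^k, where T' =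
diag(M_i^{⊗p})(Pᵀ⊗I) has the spectral radius of T_p because ab and ba share their nonzero spectrum
(`transferMatrix'_pow_apply`, `specRadius_transferMatrix`). Entries of X^{⊗p} are always O(‖X‖^p).
The converse, ‖X‖^p bounded by a fixed linear functional of X^{⊗p} along the products, is what the
assumption on p supplies: through the Frobenius norm for p = 2, through a functional positive on the
cone for p = 1. Hence E‖A_k⋯A_1‖^p is comparable, up to constants, to the norm of the s-th block
column of T'^k (`exists_hasGrowthRate_pathExp`).

That block column is an orbit of a linear operator, so its k-th roots converge: on the cyclic
subspace of the orbit, the orbit and the powers of the operator have comparable norms, and Gelfand's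
formula applies (`exists_hasGrowthRate_norm_pow_apply`). As T'^k is the sum of its block columns,
the largest rate is ρ(T').

Under the extra assumptions, comparing expectations through the first step of the chain makes all
rates equal (`growthRate_le_of_pos`, `growthRate_le_of_step`). -/

namespace MarkovSwitched

/-! ### Exponential growth rates of sequences -/

/-- The sequence `a` grows at the exponential rate `l`: `a_k^{1/k} → l`. -/
def HasGrowthRate (a : ℕ → ℝ) (l : ℝ) : Prop :=
  Tendsto (fun k : ℕ => a k ^ (1 / (k : ℝ))) atTop (𝓝 l)

theorem hasGrowthRate_const {c : ℝ} (hc : 0 < c) : HasGrowthRate (fun _ => c) 1 := by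
  have h : Tendsto (fun k : ℕ => 1 / (k : ℝ)) atTop (𝓝 0) := tendsto_one_div_atTop_nhds_zero_nat
  have h2 := (tendsto_const_nhds (x := c)).rpow h (Or.inl hc.ne')
  rwa [Real.rpow_zero] at h2

theorem HasGrowthRate.const_mul {a : ℕ → ℝ} {l c : ℝ} (h : HasGrowthRate a l)
    (ha : ∀ k, 0 ≤ a k) (hc : 0 < c) : HasGrowthRate (fun k => c * a k) l := by
  have := (hasGrowthRate_const hc).mul h
  rw [one_mul] at this
  refine this.congr fun k => ?_
  rw [Real.mul_rpow hc.le (ha k)]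

/-- Comparability up to a constant preserves the rate, since c^{1/k} → 1. -/
theorem HasGrowthRate.of_le_of_le {a b : ℕ → ℝ} {l c : ℝ} (hb : HasGrowthRate b l)
    (ha0 : ∀ k, 0 ≤ a k) (hb0 : ∀ k, 0 ≤ b k) (hc : 0 < c)
    (hab : ∀ k, a k ≤ c * b k) (hba : ∀ k, b k ≤ c * a k) : HasGrowthRate a l := by
  refine tendsto_of_tendsto_of_tendsto_of_le_of_le (hb.const_mul hb0 (inv_pos.2 hc))
    (hb.const_mul hb0 hc) (fun k => ?_) (fun k => ?_)
  · refine Real.rpow_le_rpow (mul_nonneg (inv_pos.2 hc).le (hb0 k)) ?_ (by positivity)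
    rw [inv_mul_le_iff₀ hc]
    exact hba k
  · exact Real.rpow_le_rpow (ha0 k) (hab k) (by positivity)

theorem HasGrowthRate.le_of_le {a b : ℕ → ℝ} {l m c : ℝ} (ha : HasGrowthRate a l)
    (hb : HasGrowthRate b m) (ha0 : ∀ k, 0 ≤ a k) (hb0 : ∀ k, 0 ≤ b k) (hc : 0 < c)
    (hab : ∀ k, a k ≤ c * b k) : l ≤ m :=
  le_of_tendsto_of_tendsto' ha (hb.const_mul hb0 hc) fun k =>
    Real.rpow_le_rpow (ha0 k) (hab k) (by positivity)

theorem HasGrowthRate.nonneg {a : ℕ → ℝ} {l : ℝ} (h : HasGrowthRate a l) (ha : ∀ k, 0 ≤ a k) :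
    0 ≤ l :=
  ge_of_tendsto' h fun k => Real.rpow_nonneg (ha k) _

theorem HasGrowthRate.shift {a : ℕ → ℝ} {l : ℝ} (h : HasGrowthRate a l) (ha : ∀ k, 0 ≤ a k) :
    HasGrowthRate (fun k => a (k + 1)) l := by
  have h1 : Tendsto (fun k : ℕ => a (k + 1) ^ (1 / ((k + 1 : ℕ) : ℝ))) atTop (𝓝 l) :=
    h.comp (tendsto_add_atTop_nat 1)
  -- The exponent 1 + 1/k = (k+1)/k turns the (k+1)-th root into the k-th root.
  have h2 : Tendsto (fun k : ℕ => 1 + 1 / (k : ℝ)) atTop (𝓝 1) := by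
    simpa using tendsto_const_nhds.add (tendsto_one_div_atTop_nhds_zero_nat (𝕜 := ℝ))
  have h3 := h1.rpow h2 (Or.inr one_pos)
  rw [Real.rpow_one] at h3
  refine h3.congr' ?_
  filter_upwards [eventually_gt_atTop 0] with k hk
  rw [← Real.rpow_mul (ha _)]
  congr 1
  have : (k : ℝ) ≠ 0 := by positivity
  push_cast
  field_simp

/-- If `b` is dominated by a finite sum of sequences with growth rates below `m`, then its growth
rate is below `m`. -/
theorem HasGrowthRate.exists_le_of_le_sum {ι : Type*} [Fintype ι] [Nonempty ι] {a : ι → ℕ → ℝ}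
    {l : ι → ℝ} {b : ℕ → ℝ} {m : ℝ} (ha : ∀ i, HasGrowthRate (a i) (l i))
    (hb : HasGrowthRate b m) (ha0 : ∀ i k, 0 ≤ a i k) (hb0 : ∀ k, 0 ≤ b k)
    (hab : ∀ k, b k ≤ ∑ i, a i k) : ∃ i, m ≤ l i := by
  by_contra! hlt
  obtain ⟨i₀, hi₀⟩ := Finite.exists_max l
  -- With r strictly between the largest rate and m, eventually b_k ≤ |ι| r^k, which forces m ≤ r.
  obtain ⟨r, hr₁, hr₂⟩ := exists_between (hlt i₀)
  have hr0 : 0 ≤ r := ((ha i₀).nonneg (ha0 i₀)).trans hr₁.le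
  have hev : ∀ᶠ k : ℕ in atTop, ∀ i, a i k ^ (1 / (k : ℝ)) < r :=
    eventually_all.2 fun i => (ha i).eventually_lt_const ((hi₀ i).trans_lt hr₁)
  refine hr₂.not_ge ?_
  have hcard : (0 : ℝ) < Fintype.card ι := by exact_mod_cast Fintype.card_pos
  have hlim := (hasGrowthRate_const hcard).mul_const r
  rw [one_mul] at hlim
  refine le_of_tendsto_of_tendsto hb hlim ?_
  filter_upwards [hev, eventually_gt_atTop 0] with k hk hk0
  have hk' : (k : ℝ) ≠ 0 := by positivity
  have hak : ∀ i, a i k ≤ r ^ k := fun i => by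
    have := Real.rpow_le_rpow (Real.rpow_nonneg (ha0 i k) _) (hk i).le (Nat.cast_nonneg k)
    rwa [← Real.rpow_mul (ha0 i k), one_div_mul_cancel hk', Real.rpow_one,
      Real.rpow_natCast] at this
  have hbk : b k ≤ Fintype.card ι * r ^ k := by
    refine (hab k).trans ((Finset.sum_le_sum fun i _ => hak i).trans ?_)
    simp
  calc b k ^ (1 / (k : ℝ)) ≤ (Fintype.card ι * r ^ k) ^ (1 / (k : ℝ)) :=
        Real.rpow_le_rpow (hb0 k) hbk (by positivity)
    _ = _ := by
        rw [Real.mul_rpow hcard.le (by positivity), ← Real.rpow_natCast r k, ← Real.rpow_mul hr0,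
          mul_one_div_cancel hk', Real.rpow_one]

/-! ### Gelfand's formula and orbits of operators -/

/-- Gelfand's formula. -/
theorem hasGrowthRate_norm_pow {A : Type*} [NormedRing A] [NormedAlgebra ℂ A] [CompleteSpace A]
    (a : A) : HasGrowthRate (fun k => ‖a ^ k‖) (spectralRadius ℂ a).toReal := by
  have htop : spectralRadius ℂ a ≠ ⊤ := by
    refine ne_top_of_le_ne_top ?_ (spectrum.spectralRadius_le_pow_nnnorm_pow_one_div ℂ a 0)
    simp [← ENNReal.coe_mul]
  refine ((ENNReal.tendsto_toReal htop).comp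
    (spectrum.pow_norm_pow_one_div_tendsto_nhds_spectralRadius a)).congr fun k => ?_
  simp only [Function.comp_apply]
  rw [ENNReal.toReal_ofReal (by positivity)]

/-- The powers of an operator with a cyclic vector are dominated by their values there. -/
theorem exists_norm_pow_le_of_cyclic {W : Type*} [NormedAddCommGroup W] [NormedSpace ℂ W]
    [FiniteDimensional ℂ W] (g : W →L[ℂ] W) (w : W)
    (hw : Submodule.span ℂ (Set.range fun k : ℕ => (g ^ k) w) = ⊤) :
    ∃ C, 0 < C ∧ ∀ k : ℕ, ‖g ^ k‖ ≤ C * ‖(g ^ k) w‖ := by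
  -- Evaluation at w is injective on the span of the powers of g: an element commuting with g and
  -- killing w kills the whole orbit, hence W. In finite dimension an injective linear map is
  -- bounded below.
  let S : Submodule ℂ (W →L[ℂ] W) := Submodule.span ℂ (Set.range fun k : ℕ => g ^ k)
  let Φ : S →ₗ[ℂ] W := (ContinuousLinearMap.apply ℂ W w).toLinearMap ∘ₗ S.subtype
  have hcomm : ∀ h ∈ S, ∀ k : ℕ, h * g ^ k = g ^ k * h := by
    intro h hh k
    induction hh using Submodule.span_induction with
    | mem x hx =>
      obtain ⟨j, rfl⟩ := hx
      simp only [← pow_add, add_comm]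
    | zero => simp
    | add x y _ _ hx hy => rw [add_mul, mul_add, hx, hy]
    | smul c x _ hx => rw [smul_mul_assoc, mul_smul_comm, hx]
  have hker : Φ.ker = ⊥ := by
    rw [LinearMap.ker_eq_bot']
    rintro ⟨h, hh⟩ hz
    have hz' : h w = 0 := hz
    refine Subtype.ext (ContinuousLinearMap.ext fun x => ?_)
    have hx : x ∈ Submodule.span ℂ (Set.range fun k : ℕ => (g ^ k) w) := hw ▸ Submodule.mem_top
    change h x = 0
    induction hx using Submodule.span_induction with
    | mem x hx =>
      obtain ⟨k, rfl⟩ := hx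
      change (h * g ^ k) w = 0
      rw [hcomm h hh k, mul_apply_eq_comp, hz', map_zero]
    | zero => exact map_zero h
    | add x y _ _ hx hy => rw [map_add, hx, hy, add_zero]
    | smul c x _ hx => rw [map_smul, hx, smul_zero]
  obtain ⟨K, hK0, hK⟩ := LinearMap.exists_antilipschitzWith (𝕜 := ℂ) (E := S) (F := W) Φ hker
  refine ⟨K, by exact_mod_cast hK0, fun k => ?_⟩
  have h2 := hK.le_mul_dist ⟨g ^ k, Submodule.subset_span ⟨k, rfl⟩⟩ 0
  rw [map_zero, dist_zero_right, dist_zero_right] at h2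
  exact h2

/-- The orbit of a vector under a linear operator has an exponential growth rate. -/
theorem exists_hasGrowthRate_norm_pow_apply {E : Type*} [NormedAddCommGroup E] [NormedSpace ℂ E]
    [FiniteDimensional ℂ E] (f : E →L[ℂ] E) (v : E) :
    ∃ l, HasGrowthRate (fun k => ‖(f ^ k) v‖) l := by
  -- On the span of its orbit, v is cyclic; the rate is the spectral radius of f restricted there.
  let W : Submodule ℂ E := Submodule.span ℂ (Set.range fun k : ℕ => (f ^ k) v)
  have hWv : v ∈ W := Submodule.subset_span ⟨0, by simp⟩
  have hWf : ∀ x ∈ W, f x ∈ W := by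
    intro x hx
    induction hx using Submodule.span_induction with
    | mem x hx =>
      obtain ⟨k, rfl⟩ := hx
      exact Submodule.subset_span ⟨k + 1, by simp [pow_succ']⟩
    | zero => simp
    | add x y _ _ hx hy => rw [map_add]; exact W.add_mem hx hy
    | smul c x _ hx => rw [map_smul]; exact W.smul_mem c hx
  let g : W →L[ℂ] W := (f.comp W.subtypeL).codRestrict W fun x => hWf x x.2
  let w : W := ⟨v, hWv⟩
  have hgk : ∀ (k : ℕ) (x : W), ((g ^ k) x : E) = (f ^ k) x := by
    intro k
    induction k with
    | zero => simp
    | succ k ih =>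
      intro x
      rw [pow_succ, pow_succ, mul_apply_eq_comp, mul_apply_eq_comp, ih]
      rfl
  have hspan : Submodule.span ℂ (Set.range fun k : ℕ => (g ^ k) w) = ⊤ := by
    refine Submodule.map_injective_of_injective W.injective_subtype ?_
    rw [Submodule.map_span, ← Set.range_comp, Submodule.map_top, Submodule.range_subtype]
    congr 2
    ext k
    exact hgk k w
  have : CompleteSpace W := FiniteDimensional.complete ℂ W
  obtain ⟨C, hC0, hC⟩ := exists_norm_pow_le_of_cyclic g w hspan
  have h1 : ∀ k, ‖(f ^ k) v‖ = ‖(g ^ k) w‖ := fun k => by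
    rw [← hgk k w]
    rfl
  refine ⟨_, (hasGrowthRate_norm_pow g).of_le_of_le (c := max C (‖w‖ + 1))
    (fun _ => norm_nonneg _) (fun k => norm_nonneg (g ^ k)) (lt_max_of_lt_left hC0)
    (fun k => ?_) (fun k => ?_)⟩
  · rw [h1, mul_comm]
    refine ((g ^ k).le_opNorm w).trans (mul_le_mul_of_nonneg_left ?_ (norm_nonneg _))
    exact (le_add_of_nonneg_right zero_le_one).trans (le_max_right _ _)
  · rw [h1]
    exact (hC k).trans (mul_le_mul_of_nonneg_right (le_max_left _ _) (norm_nonneg _))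

/-- The sequence a^k b is the orbit of b under left multiplication by a. -/
theorem exists_hasGrowthRate_norm_pow_mul {A : Type*} [NormedRing A] [NormedAlgebra ℂ A]
    [FiniteDimensional ℂ A] (a b : A) : ∃ l, HasGrowthRate (fun k => ‖a ^ k * b‖) l := by
  obtain ⟨l, hl⟩ := exists_hasGrowthRate_norm_pow_apply (ContinuousLinearMap.mul ℂ A a) b
  have h : ∀ k : ℕ, (ContinuousLinearMap.mul ℂ A a ^ k) b = a ^ k * b := by
    intro k
    induction k with
    | zero => simp
    | succ k ih =>
      rw [pow_succ', mul_apply_eq_comp, ih, ContinuousLinearMap.mul_apply', pow_succ', mul_assoc]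
  simp only [h] at hl
  exact ⟨l, hl⟩

/-! ### Comparing norms with matrix entries -/

/-- On a finite-dimensional space, every linear functional is bounded with respect to every
norm. -/
theorem exists_abs_le_mul_of_definite {V : Type*} [AddCommGroup V] [Module ℝ V]
    [FiniteDimensional ℝ V] (ν : Seminorm ℝ V) (hν : ∀ x, ν x = 0 → x = 0) (φ : V →ₗ[ℝ] ℝ) :
    ∃ C, 0 < C ∧ ∀ x, |φ x| ≤ C * ν x := by
  let _ : NormedAddCommGroup V := AddGroupNorm.toNormedAddCommGroup
    { ν with eq_zero_of_map_eq_zero' := hν }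
  let _ : NormedSpace ℝ V := ⟨fun a b => (map_smul_eq_mul ν a b).le⟩
  refine ⟨‖LinearMap.toContinuousLinearMap φ‖ + 1, by positivity, fun x => ?_⟩
  refine ((LinearMap.toContinuousLinearMap φ).le_opNorm x).trans ?_
  have : ‖x‖ = ν x := rfl
  rw [this]
  exact mul_le_mul_of_nonneg_right (by linarith) (apply_nonneg ν x)

theorem exists_abs_apply_le {m n : Type*} [Fintype m] [Fintype n]
    (ν : Seminorm ℝ (Matrix m n ℝ)) (hν : ∀ X, ν X = 0 → X = 0) :
    ∃ C, 0 < C ∧ ∀ X i j, |X i j| ≤ C * ν X := by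
  choose C hC0 hC using fun q : m × n =>
    exists_abs_le_mul_of_definite ν hν (Matrix.entryLinearMap ℝ ℝ q.1 q.2)
  refine ⟨∑ q, C q + 1, add_pos_of_nonneg_of_pos (Finset.sum_nonneg fun q _ => (hC0 q).le)
    one_pos, fun X i j => (hC (i, j) X).trans ?_⟩
  refine mul_le_mul_of_nonneg_right ?_ (apply_nonneg ν X)
  have := Finset.single_le_sum (fun q _ => (hC0 q).le) (Finset.mem_univ (i, j))
  linarith

theorem exists_seminorm_le_sum_abs {m n : Type*} [Fintype m] [Fintype n]
    (ν : Seminorm ℝ (Matrix m n ℝ)) :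
    ∃ C, 0 < C ∧ ∀ X, ν X ≤ C * ∑ i, ∑ j, |X i j| := by
  classical
  let c : m → n → ℝ := fun i j => ν (Matrix.single i j 1)
  have hc : ∀ i j, 0 ≤ c i j := fun i j => apply_nonneg ν _
  refine ⟨∑ i, ∑ j, c i j + 1, add_pos_of_nonneg_of_pos
    (Finset.sum_nonneg fun i _ => Finset.sum_nonneg fun j _ => hc i j) one_pos, fun X => ?_⟩
  have hsum : ν X ≤ ∑ i, ∑ j, |X i j| * c i j := by
    conv_lhs => rw [Matrix.matrix_eq_sum_single X]
    refine (Finset.le_sum_of_subadditive ν (map_zero ν).le (map_add_le_add ν) _ _).trans (Finset.sum_le_sum fun i _ => ?_)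
    refine (Finset.le_sum_of_subadditive ν (map_zero ν).le (map_add_le_add ν) _ _).trans (Finset.sum_le_sum fun j _ => ?_)
    have : Matrix.single i j (X i j) = X i j • Matrix.single i j (1 : ℝ) := by
      rw [Matrix.smul_single, smul_eq_mul, mul_one]
    rw [this, map_smul_eq_mul, Real.norm_eq_abs]
  refine hsum.trans ?_
  rw [Finset.mul_sum]
  refine Finset.sum_le_sum fun i _ => ?_
  rw [Finset.mul_sum]
  refine Finset.sum_le_sum fun j _ => ?_
  rw [mul_comm]
  refine mul_le_mul_of_nonneg_right ?_ (abs_nonneg _)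
  have h1 := Finset.single_le_sum (fun j _ => hc i j) (Finset.mem_univ j)
  have h2 := Finset.single_le_sum (f := fun i => ∑ j, c i j)
    (fun i _ => Finset.sum_nonneg fun j _ => hc i j) (Finset.mem_univ i)
  linarith

/-! ### Functionals adapted to a proper cone -/

/-- For a proper cone there is a linear functional bounded below by a multiple of the norm. -/
theorem IsProperCone.exists_functional {d : ℕ} {K : Set (Fin d → ℝ)} (hK : IsProperCone K) :
    ∃ φ : (Fin d → ℝ) →L[ℝ] ℝ, ∃ c, 0 < c ∧ ∀ x ∈ K, c * ‖x‖ ≤ φ x := by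
  have hne : K.Nonempty := hK.solid.mono interior_subset
  have h0 : (0 : Fin d → ℝ) ∈ K := by
    obtain ⟨x, hx⟩ := hne
    simpa using hK.smul_mem 0 le_rfl x hx
  have hcpt : IsCompact (K ∩ Metric.sphere 0 1) := (isCompact_sphere _ _).inter_left hK.isClosed
  have hsep : ∀ x : Fin d → ℝ, ∃ f : (Fin d → ℝ) →L[ℝ] ℝ, (∀ y ∈ K, 0 ≤ f y) ∧
      (x ∈ K ∩ Metric.sphere 0 1 → 0 < f x) := by
    intro x
    by_cases hx : x ∈ K ∩ Metric.sphere 0 1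
    swap
    · exact ⟨0, by simp, fun h => absurd h hx⟩
    have hx0 : x ≠ 0 := by
      rintro rfl
      simp at hx
    -- Separating -x, which is outside K by pointedness, from K gives f(-x) < u < f on K; scaling
    -- inside the cone upgrades this to f ≥ 0 on K.
    obtain ⟨f, u, hfx, hfK⟩ := geometric_hahn_banach_point_closed hK.convex hK.isClosed
      (fun h => hx0 (hK.pointed x hx.1 h))
    have hu : u < 0 := by simpa using hfK 0 h0
    refine ⟨f, fun y hy => ?_, fun _ => ?_⟩
    · by_contra! hlt
      have := hfK _ (hK.smul_mem (u / f y) (div_nonneg_of_nonpos hu.le hlt.le) y hy)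
      rw [map_smul, smul_eq_mul, div_mul_cancel₀ _ hlt.ne] at this
      exact lt_irrefl _ this
    · rw [map_neg] at hfx
      linarith
  choose f hf0 hf using hsep
  -- By compactness, finitely many such f suffice for their sum to be positive on every unit vector
  -- of K.
  obtain ⟨t, ht⟩ := hcpt.elim_finite_subcover (fun x => {y | 0 < f x y})
    (fun x => isOpen_lt continuous_const (f x).continuous)
    (fun x hx => Set.mem_iUnion.2 ⟨x, hf x hx⟩)
  let φ : (Fin d → ℝ) →L[ℝ] ℝ := ∑ x ∈ t, f x
  have hφ : ∀ y ∈ K ∩ Metric.sphere 0 1, 0 < φ y := by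
    intro y hy
    obtain ⟨x, hx, hxy⟩ : ∃ x ∈ t, 0 < f x y := by simpa using ht hy
    have : φ y = ∑ x ∈ t, f x y := by simp [φ]
    rw [this]
    exact Finset.sum_pos' (fun z _ => hf0 z y hy.1) ⟨x, hx, hxy⟩
  obtain ⟨c, hc0, hc⟩ := hcpt.exists_forall_le' φ.continuous.continuousOn hφ
  refine ⟨φ, c, hc0, fun x hx => ?_⟩
  rcases eq_or_ne x 0 with rfl | hx0
  · simp
  have hnx : 0 < ‖x‖ := norm_pos_iff.2 hx0
  have := hc (‖x‖⁻¹ • x) ⟨hK.smul_mem _ (by positivity) x hx, by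
    simp [norm_smul, hnx.ne']⟩
  rw [map_smul, smul_eq_mul, le_inv_mul_iff₀ hnx] at this
  linarith

/-- The entries of the matrices that leave a proper cone invariant are dominated by a single
linear functional. -/
theorem IsProperCone.exists_abs_apply_le {d : ℕ} {K : Set (Fin d → ℝ)} (hK : IsProperCone K) :
    ∃ u v : Fin d → ℝ, ∀ X : Matrix (Fin d) (Fin d) ℝ, LeavesInvariant X K →
      ∀ i j, |X i j| ≤ ∑ a, ∑ b, (u a * v b) * X a b := by
  obtain ⟨φ, c, hc, hφ⟩ := hK.exists_functional
  obtain ⟨v, hv⟩ := hK.solid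
  obtain ⟨r, hr, hball⟩ := Metric.mem_nhds_iff.1 (mem_interior_iff_mem_nhds.1 hv)
  refine ⟨fun a => (2 / r) * c⁻¹ * φ (Pi.single a 1), v, fun X hX i j => ?_⟩
  -- Since v ± y ∈ K, adding the bounds for φ(X(v ± y)) gives c‖Xy‖ ≤ φ(Xv), while ‖Xy‖ ≥ |X i j|
  -- r/2; hence the factor 2/(rc).
  let y : Fin d → ℝ := Pi.single j (r / 2)
  have hy : ‖y‖ < r := by
    rw [Pi.norm_single, Real.norm_eq_abs, abs_of_pos (by positivity)]
    linarith
  have hadd : v + y ∈ K := hball (by simpa [Metric.mem_ball, dist_eq_norm] using hy)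
  have hsub : v - y ∈ K := hball (by simpa [Metric.mem_ball, dist_eq_norm] using hy)
  have h1 := hφ _ (hX _ hadd)
  have h2 := hφ _ (hX _ hsub)
  have h3 : ‖X.mulVec (v + y) - X.mulVec (v - y)‖ ≤ ‖X.mulVec (v + y)‖ + ‖X.mulVec (v - y)‖ :=
    norm_sub_le _ _
  have h4 : X.mulVec (v + y) - X.mulVec (v - y) = (2 : ℝ) • X.mulVec y := by
    rw [Matrix.mulVec_add, Matrix.mulVec_sub, two_smul]
    abel
  rw [h4, norm_smul, Real.norm_eq_abs, abs_two] at h3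
  rw [Matrix.mulVec_add, map_add] at h1
  rw [Matrix.mulVec_sub, map_sub] at h2
  rw [Matrix.mulVec_add, Matrix.mulVec_sub] at h3
  have h5 : c * ‖X.mulVec y‖ ≤ φ (X.mulVec v) := by nlinarith
  have h6 : |X i j| * (r / 2) ≤ ‖X.mulVec y‖ := by
    have := norm_le_pi_norm (X.mulVec y) i
    have hXy : X.mulVec y i = X i j * (r / 2) := by
      simp [Matrix.mulVec, dotProduct, y, Pi.single_apply]
    rwa [hXy, norm_mul, Real.norm_eq_abs, Real.norm_eq_abs, abs_of_pos (half_pos hr)] at this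
  have h7 : φ (X.mulVec v) = ∑ a, X.mulVec v a * φ (Pi.single a 1) := by
    conv_lhs => rw [pi_eq_sum_univ' (X.mulVec v), map_sum]
    refine Finset.sum_congr rfl fun a _ => ?_
    rw [map_smul, smul_eq_mul]
  have h8 : ∑ a, ∑ b, ((2 / r) * c⁻¹ * φ (Pi.single a 1) * v b) * X a b
      = (2 / r) * c⁻¹ * φ (X.mulVec v) := by
    rw [h7, Finset.mul_sum]
    refine Finset.sum_congr rfl fun a _ => ?_
    rw [Matrix.mulVec, dotProduct, Finset.sum_mul, Finset.mul_sum]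
    exact Finset.sum_congr rfl fun b _ => by ring
  rw [h8]
  calc |X i j| = (2 / r) * c⁻¹ * (c * (|X i j| * (r / 2))) := by field_simp
    _ ≤ (2 / r) * c⁻¹ * (c * ‖X.mulVec y‖) := by gcongr
    _ ≤ _ := by gcongr

/-! ### Expectations as sums over paths -/

section

variable {N d : ℕ} (P : Matrix (Fin N) (Fin N) ℝ) (M : Fin N → Matrix (Fin d) (Fin d) ℝ)

/-- The expectation of `g (A_k ⋯ A_1) σ_k` for the chain started at `s`, as a sum over paths,
organized by the first step of the chain. -/
def pathExp : ℕ → (Matrix (Fin d) (Fin d) ℝ → Fin N → ℝ) → Fin N → ℝ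
  | 0, g, s => g 1 s
  | k + 1, g, s => ∑ j, P s j * pathExp k (fun X l => g (X * M j) l) j

theorem pathExp_zero (g : Matrix (Fin d) (Fin d) ℝ → Fin N → ℝ) (s : Fin N) :
    pathExp P M 0 g s = g 1 s := rfl

theorem pathExp_succ (k : ℕ) (g : Matrix (Fin d) (Fin d) ℝ → Fin N → ℝ) (s : Fin N) :
    pathExp P M (k + 1) g s = ∑ j, P s j * pathExp P M k (fun X l => g (X * M j) l) j := rfl

/-- Decomposition according to the last step of the chain. -/
theorem pathExp_succ_last (k : ℕ) (g : Matrix (Fin d) (Fin d) ℝ → Fin N → ℝ) (s : Fin N) :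
    pathExp P M (k + 1) g s = pathExp P M k (fun X i => ∑ j, P i j * g (M j * X) j) s := by
  induction k generalizing g s with
  | zero => simp [pathExp]
  | succ k ih =>
    rw [pathExp_succ, pathExp_succ P M k]
    refine Finset.sum_congr rfl fun j _ => ?_
    rw [ih]
    simp only [mul_assoc]

theorem pathExp_const_mul (k : ℕ) (c : ℝ) (g : Matrix (Fin d) (Fin d) ℝ → Fin N → ℝ)
    (s : Fin N) : pathExp P M k (fun X l => c * g X l) s = c * pathExp P M k g s := by
  induction k generalizing g s with
  | zero => rfl
  | succ k ih =>
    simp only [pathExp_succ, ih, Finset.mul_sum]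
    exact Finset.sum_congr rfl fun j _ => mul_left_comm _ _ _

theorem pathExp_sum {ι : Type*} (k : ℕ) (t : Finset ι)
    (g : ι → Matrix (Fin d) (Fin d) ℝ → Fin N → ℝ) (s : Fin N) :
    pathExp P M k (fun X l => ∑ i ∈ t, g i X l) s = ∑ i ∈ t, pathExp P M k (g i) s := by
  induction k generalizing g s with
  | zero => rfl
  | succ k ih =>
    simp only [pathExp_succ, ih, Finset.mul_sum]
    exact Finset.sum_comm

variable {P M}

/-- The comparison is required only on `S`, which contains every product of the M_j; this is where
cone invariance can enter. -/
theorem pathExp_mono (hP : ∀ i j, 0 ≤ P i j) {S : Submonoid (Matrix (Fin d) (Fin d) ℝ)}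
    (hS : ∀ j, M j ∈ S) (k : ℕ) {g h : Matrix (Fin d) (Fin d) ℝ → Fin N → ℝ}
    (hgh : ∀ X ∈ S, ∀ l, g X l ≤ h X l) (s : Fin N) :
    pathExp P M k g s ≤ pathExp P M k h s := by
  induction k generalizing g h s with
  | zero => exact hgh 1 S.one_mem s
  | succ k ih =>
    exact Finset.sum_le_sum fun j _ => mul_le_mul_of_nonneg_left
      (ih (fun X hX l => hgh _ (S.mul_mem hX (hS j)) l) j) (hP s j)

theorem pathExp_nonneg (hP : ∀ i j, 0 ≤ P i j) (k : ℕ)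
    {g : Matrix (Fin d) (Fin d) ℝ → Fin N → ℝ} (hg : ∀ X l, 0 ≤ g X l) (s : Fin N) :
    0 ≤ pathExp P M k g s := by
  induction k generalizing g s with
  | zero => exact hg 1 s
  | succ k ih =>
    exact Finset.sum_nonneg fun j _ => mul_nonneg (hP s j) (ih (fun X l => hg _ l) j)

theorem abs_pathExp_le (hP : ∀ i j, 0 ≤ P i j) (k : ℕ)
    {g h : Matrix (Fin d) (Fin d) ℝ → Fin N → ℝ} (hgh : ∀ X l, |g X l| ≤ h X l) (s : Fin N) :
    |pathExp P M k g s| ≤ pathExp P M k h s := by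
  induction k generalizing g h s with
  | zero => exact hgh 1 s
  | succ k ih =>
    refine (Finset.abs_sum_le_sum_abs _ _).trans (Finset.sum_le_sum fun j _ => ?_)
    rw [abs_mul, abs_of_nonneg (hP s j)]
    exact mul_le_mul_of_nonneg_left (ih (fun X l => hgh _ l) j) (hP s j)

end

/-! ### Kronecker powers and the transfer matrix -/

theorem kronPow_mul {d : ℕ} (X Y : Matrix (Fin d) (Fin d) ℝ) (p : ℕ) :
    kronPow (X * Y) p = kronPow X p * kronPow Y p := by
  ext a b
  simp only [kronPow, Matrix.of_apply, Matrix.mul_apply]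
  rw [Finset.prod_univ_sum, Fintype.piFinset_univ]
  exact Finset.sum_congr rfl fun c _ => Finset.prod_mul_distrib

theorem kronPow_one {d : ℕ} (p : ℕ) :
    kronPow (1 : Matrix (Fin d) (Fin d) ℝ) p = 1 := by
  ext a b
  simp only [kronPow, Matrix.of_apply, Matrix.one_apply]
  rw [Finset.prod_ite_zero]
  simp [funext_iff]

/-- The matrix `diag(M_1^{⊗p}, …, M_N^{⊗p}) (Pᵀ ⊗ I)`. -/
def transferMatrix' {N d : ℕ} (P : Matrix (Fin N) (Fin N) ℝ)
    (M : Fin N → Matrix (Fin d) (Fin d) ℝ) (p : ℕ) :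
    Matrix (Fin N × (Fin p → Fin d)) (Fin N × (Fin p → Fin d)) ℝ :=
  (Matrix.blockDiagonal fun i => kronPow (M i) p).submatrix Prod.swap Prod.swap *
    (P.transpose ⊗ₖ (1 : Matrix (Fin p → Fin d) (Fin p → Fin d) ℝ))

theorem transferMatrix'_apply {N d : ℕ} (P : Matrix (Fin N) (Fin N) ℝ)
    (M : Fin N → Matrix (Fin d) (Fin d) ℝ) (p : ℕ) (j i : Fin N) (a b : Fin p → Fin d) :
    transferMatrix' P M p (j, a) (i, b) = P i j * kronPow (M j) p a b := by
  simp [transferMatrix', Matrix.mul_apply, Fintype.sum_prod_type, Matrix.blockDiagonal_apply,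
    Matrix.one_apply, mul_comm]

theorem spectralRadius_mul_comm {A : Type*} [Ring A] [Algebra ℂ A] (a b : A) :
    spectralRadius ℂ (a * b) = spectralRadius ℂ (b * a) := by
  have key : ∀ a b : A, spectralRadius ℂ (a * b) ≤ spectralRadius ℂ (b * a) := by
    intro a b
    refine iSup₂_le fun z hz => ?_
    rcases eq_or_ne z 0 with rfl | hz0
    · simp
    · have : z ∈ spectrum ℂ (b * a) \ {0} := by
        rw [← spectrum.nonzero_mul_comm]
        exact ⟨hz, hz0⟩
      exact le_iSup₂ (f := fun (z : ℂ) (_ : z ∈ spectrum ℂ (b * a)) => (‖z‖₊ : ENNReal)) z this.1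
  exact le_antisymm (key a b) (key b a)

/-- A step i → j carries M_j in `transferMatrix'` but M_i in `transferMatrix`. The former fits
A_k⋯A_1, which omits A_0. -/
theorem specRadius_transferMatrix {N d : ℕ} (P : Matrix (Fin N) (Fin N) ℝ)
    (M : Fin N → Matrix (Fin d) (Fin d) ℝ) (p : ℕ) :
    specRadius (transferMatrix P M p) = specRadius (transferMatrix' P M p) := by
  unfold specRadius transferMatrix transferMatrix'
  rw [Matrix.map_mul, Matrix.map_mul, spectralRadius_mul_comm]

/-- The entries of the powers of the transfer matrix are expectations of entries of Kronecker
powers. -/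
theorem transferMatrix'_pow_apply {N d : ℕ} (P : Matrix (Fin N) (Fin N) ℝ)
    (M : Fin N → Matrix (Fin d) (Fin d) ℝ) (p k : ℕ) (j i : Fin N) (a b : Fin p → Fin d) :
    (transferMatrix' P M p ^ k) (j, a) (i, b) =
      pathExp P M k (fun X l => if l = j then kronPow X p a b else 0) i := by
  induction k generalizing j a with
  | zero =>
    by_cases h : i = j
    · subst h
      simp [pathExp_zero, kronPow_one, Matrix.one_apply]
    · simp [pathExp_zero, h, Ne.symm h]
  | succ k ih =>
    -- A factor T' on the left appends the last step of the path.
    rw [pathExp_succ_last, pow_succ', Matrix.mul_apply, Fintype.sum_prod_type]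
    simp only [ih, transferMatrix'_apply]
    simp_rw [← pathExp_const_mul, ← pathExp_sum]
    congr 1
    ext X l
    simp [kronPow_mul, Matrix.mul_apply, Finset.mul_sum, mul_assoc, mul_ite]

/-! ### The Markov chain and its path sums -/

/-- The integral of a function of a random variable with finitely many values. -/
theorem integral_comp_fintype {Ω H : Type*} [MeasurableSpace Ω] (μ : Measure Ω)
    [IsFiniteMeasure μ] [Fintype H] [MeasurableSpace H] [MeasurableSingletonClass H]
    {Y : Ω → H} (hY : Measurable Y) (f : H → ℝ) :
    ∫ ω, f (Y ω) ∂μ = ∑ y, μ.real {ω | Y ω = y} * f y := by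
  rw [← integral_map hY.aemeasurable (Measurable.of_discrete).aestronglyMeasurable,
    integral_fintype Integrable.of_finite]
  refine Finset.sum_congr rfl fun y _ => ?_
  rw [map_measureReal_apply hY (measurableSet_singleton y), smul_eq_mul]
  rfl

/-- The Markov property, integrated against functions of the history. -/
theorem IsMarkovChain.integral_succ {N : ℕ} {P : Matrix (Fin N) (Fin N) ℝ} {s₀ : Fin N}
    {Ω : Type*} [MeasurableSpace Ω] {μ : Measure Ω} [IsProbabilityMeasure μ]
    {σ : ℕ → Ω → Fin N} (hσ : IsMarkovChain P s₀ μ σ) (k : ℕ)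
    (F : (ℕ → Fin N) → Fin N → ℝ) (hF : ∀ s t, (∀ n ≤ k, s n = t n) → F s = F t) :
    ∫ ω, F (fun n => σ n ω) (σ (k + 1) ω) ∂μ =
      ∫ ω, ∑ j, P (σ k ω) j * F (fun n => σ n ω) j ∂μ := by
  -- A history up to time k is prolonged by repeating its last state; by `hF` the choice is
  -- irrelevant to F.
  let ext : (Fin (k + 1) → Fin N) → ℕ → Fin N := fun h n => h ⟨min n k, by omega⟩
  let Y : Ω → Fin (k + 1) → Fin N := fun ω n => σ n ω
  have hY : Measurable Y := measurable_pi_lambda _ fun n => hσ.measurable n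
  have hext : ∀ ω, F (fun n => σ n ω) = F (ext (Y ω)) := fun ω =>
    hF _ _ fun n hn => by simp [ext, Y, min_eq_left hn]
  have hk : ∀ ω, σ k ω = ext (Y ω) k := fun ω => by simp [ext, Y]
  simp only [hext, hk]
  have h1 := integral_comp_fintype μ (hY.prodMk (hσ.measurable (k + 1)))
    (fun y : (Fin (k + 1) → Fin N) × Fin N => F (ext y.1) y.2)
  have h2 := integral_comp_fintype μ hY (fun h => ∑ j, P (ext h k) j * F (ext h) j)
  refine h1.trans (Eq.trans ?_ h2.symm)
  rw [Fintype.sum_prod_type]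
  refine Finset.sum_congr rfl fun h _ => ?_
  rw [Finset.mul_sum]
  refine Finset.sum_congr rfl fun j _ => ?_
  have h3 := hσ.transition k (fun n => if n ≤ k then ext h n else j)
  have e1 : {ω | ∀ n ≤ k + 1, σ n ω = if n ≤ k then ext h n else j} =
      {ω | (Y ω, σ (k + 1) ω) = (h, j)} := by
    ext ω
    simp only [Set.mem_ofPred_eq, Prod.mk.injEq]
    constructor
    · intro hω
      refine ⟨funext fun n => ?_, by simpa using hω (k + 1) le_rfl⟩
      have hn : (n : ℕ) ≤ k := Nat.lt_succ_iff.1 n.2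
      have := hω n (hn.trans k.le_succ)
      simpa [hn, ext, Y] using this
    · rintro ⟨rfl, rfl⟩ n hn
      split_ifs with hnk
      · simp [ext, Y, min_eq_left hnk]
      · rw [le_antisymm hn (not_le.1 hnk)]
  have e2 : {ω | ∀ n ≤ k, σ n ω = if n ≤ k then ext h n else j} = {ω | Y ω = h} := by
    ext ω
    simp only [Set.mem_ofPred_eq]
    constructor
    · intro hω
      refine funext fun n => ?_
      have hn : (n : ℕ) ≤ k := Nat.lt_succ_iff.1 n.2
      simpa [hn, ext, Y] using hω n hn
    · rintro rfl n hn
      simp [ext, Y, hn]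
  rw [e1, e2] at h3
  rw [h3]
  simp [mul_assoc]

/-- Exhibits the product as a function of the history, the form to which
`IsMarkovChain.integral_succ` applies. -/
theorem revProd_comp {N d : ℕ} {Ω : Type*} (M : Fin N → Matrix (Fin d) (Fin d) ℝ)
    (σ : ℕ → Ω → Fin N) (k : ℕ) (ω : Ω) :
    revProd (fun k ω => M (σ k ω)) k ω =
      revProd (fun k (s : ℕ → Fin N) => M (s k)) k (fun n => σ n ω) := by
  induction k with
  | zero => rfl
  | succ k ih => rw [revProd, revProd, ih]

theorem revProd_congr {N d : ℕ} (M : Fin N → Matrix (Fin d) (Fin d) ℝ) (k : ℕ)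
    {s t : ℕ → Fin N} (h : ∀ n ≤ k, s n = t n) :
    revProd (fun k (s : ℕ → Fin N) => M (s k)) k s =
      revProd (fun k (s : ℕ → Fin N) => M (s k)) k t := by
  induction k with
  | zero => rfl
  | succ k ih => rw [revProd, revProd, ih fun n hn => h n (hn.trans k.le_succ), h _ le_rfl]

/-- Conditioning on the history peels off the last step, whereas `pathExp` recurses on the first;
`pathExp_succ_last` reconciles the two. -/
theorem IsMarkovChain.integral_revProd {N d : ℕ} {P : Matrix (Fin N) (Fin N) ℝ} {s₀ : Fin N}
    {Ω : Type*} [MeasurableSpace Ω] {μ : Measure Ω} [IsProbabilityMeasure μ]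
    {σ : ℕ → Ω → Fin N} (hσ : IsMarkovChain P s₀ μ σ) (M : Fin N → Matrix (Fin d) (Fin d) ℝ)
    (k : ℕ) (g : Matrix (Fin d) (Fin d) ℝ → Fin N → ℝ) :
    ∫ ω, g (revProd (fun k ω => M (σ k ω)) k ω) (σ k ω) ∂μ = pathExp P M k g s₀ := by
  induction k generalizing g with
  | zero =>
    have : ∀ᵐ ω ∂μ, g (revProd (fun k ω => M (σ k ω)) 0 ω) (σ 0 ω) = g 1 s₀ := by
      filter_upwards [hσ.initial] with ω hω
      rw [hω]
      rfl
    rw [integral_congr_ae this, integral_const, probReal_univ, one_smul, pathExp_zero]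
  | succ k ih =>
    rw [pathExp_succ_last, ← ih]
    have := hσ.integral_succ k
      (fun s j => g (M j * revProd (fun k (s : ℕ → Fin N) => M (s k)) k s) j)
      (fun s t h => by rw [revProd_congr M k h])
    simp only [← revProd_comp] at this
    exact this

/-! ### Growth of expectations and powers of the transfer matrix -/

section

attribute [local instance] Matrix.linftyOpNormedRing Matrix.linftyOpNormedAlgebra

theorem norm_map_le_sum {n : Type*} [Fintype n] [DecidableEq n] (X : Matrix n n ℝ) :
    ‖X.map (algebraMap ℝ ℂ)‖ ≤ ∑ i, ∑ j, |X i j| := by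
  have h : ‖X.map (algebraMap ℝ ℂ)‖₊ ≤ ∑ i, ∑ j, ‖X i j‖₊ := by
    rw [Matrix.linfty_opNNNorm_def]
    refine Finset.sup_le fun i _ => ?_
    simp only [Matrix.map_apply, nnnorm_algebraMap']
    exact Finset.single_le_sum (f := fun i => ∑ j, ‖X i j‖₊) (fun _ _ => zero_le)
      (Finset.mem_univ i)
  simpa using NNReal.coe_le_coe.2 h

theorem abs_apply_le_norm_map {n : Type*} [Fintype n] [DecidableEq n] (X : Matrix n n ℝ)
    (i j : n) : |X i j| ≤ ‖X.map (algebraMap ℝ ℂ)‖ := by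
  have h : ‖X i j‖₊ ≤ ‖X.map (algebraMap ℝ ℂ)‖₊ := by
    rw [Matrix.linfty_opNNNorm_def]
    refine le_trans ?_ (Finset.le_sup (Finset.mem_univ i))
    simp only [Matrix.map_apply, nnnorm_algebraMap']
    exact Finset.single_le_sum (f := fun j => ‖X i j‖₊) (fun _ _ => zero_le)
      (Finset.mem_univ j)
  simpa using NNReal.coe_le_coe.2 h

theorem hasGrowthRate_norm_map_pow {n : Type*} [Fintype n] [DecidableEq n] (T : Matrix n n ℝ) :
    HasGrowthRate (fun k => ‖(T ^ k).map (algebraMap ℝ ℂ)‖) (specRadius T) := by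
  have : CompleteSpace (Matrix n n ℂ) := FiniteDimensional.complete ℂ _
  simp only [Matrix.map_pow]
  exact hasGrowthRate_norm_pow (T.map (algebraMap ℝ ℂ))

theorem exists_hasGrowthRate_norm_map_pow_mul {n : Type*} [Fintype n] [DecidableEq n]
    (T w : Matrix n n ℝ) :
    ∃ l, HasGrowthRate (fun k => ‖(T ^ k * w).map (algebraMap ℝ ℂ)‖) l := by
  simp only [Matrix.map_mul, Matrix.map_pow]
  exact exists_hasGrowthRate_norm_pow_mul _ _

variable {N d : ℕ} {P : Matrix (Fin N) (Fin N) ℝ} {M : Fin N → Matrix (Fin d) (Fin d) ℝ}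

/-- An entry of X^{⊗p} is a product of p entries of X, each at most a constant times ν X. -/
theorem exists_abs_transferMatrix'_pow_le (hP : ∀ i j, 0 ≤ P i j) (p : ℕ)
    (ν : Seminorm ℝ (Matrix (Fin d) (Fin d) ℝ)) (hν : ∀ X, ν X = 0 → X = 0) :
    ∃ C, 0 < C ∧ ∀ k j a s b, |(transferMatrix' P M p ^ k) (j, a) (s, b)| ≤
      C * pathExp P M k (fun X _ => ν X ^ p) s := by
  obtain ⟨C, hC0, hC⟩ := exists_abs_apply_le ν hν
  refine ⟨C ^ p, by positivity, fun k j a s b => ?_⟩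
  rw [transferMatrix'_pow_apply, ← pathExp_const_mul]
  refine abs_pathExp_le hP k (fun X l => ?_) s
  have hν0 : 0 ≤ ν X := apply_nonneg ν X
  split_ifs
  · rw [kronPow, Matrix.of_apply, Finset.abs_prod, ← mul_pow]
    refine (Finset.prod_le_prod (fun _ _ => abs_nonneg _) fun l _ => hC X (a l) (b l)).trans ?_
    simp
  · simp only [abs_zero]
    positivity

theorem pathExp_le_sum_transferMatrix' (hP : ∀ i j, 0 ≤ P i j) {p : ℕ}
    {S : Submonoid (Matrix (Fin d) (Fin d) ℝ)} (hS : ∀ j, M j ∈ S)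
    {f : Matrix (Fin d) (Fin d) ℝ → ℝ} {c : (Fin p → Fin d) → (Fin p → Fin d) → ℝ}
    (hf : ∀ X ∈ S, f X ≤ ∑ a, ∑ b, c a b * kronPow X p a b) (k : ℕ) (s : Fin N) :
    pathExp P M k (fun X _ => f X) s ≤
      ∑ j, ∑ a, ∑ b, c a b * (transferMatrix' P M p ^ k) (j, a) (s, b) := by
  simp only [transferMatrix'_pow_apply, ← pathExp_const_mul, ← pathExp_sum]
  refine pathExp_mono hP hS k (fun X hX l => (hf X hX).trans (le_of_eq ?_)) s
  -- Summing over the final state j removes the indicator of σ_k = j.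
  rw [Finset.sum_eq_single l]
  · simp
  · intro j _ hj
    simp [hj.symm]
  · simp

/-- If the `p`-th power of the norm is dominated on the semigroup generated by the matrices by a
linear functional of the `p`-th Kronecker power, then the expectations have growth rates, the
largest of which is the spectral radius of the transfer matrix. -/
theorem exists_hasGrowthRate_pathExp (hN : 0 < N) (hP : ∀ i j, 0 ≤ P i j) {p : ℕ}
    (ν : Seminorm ℝ (Matrix (Fin d) (Fin d) ℝ)) (hν : ∀ X, ν X = 0 → X = 0)
    {S : Submonoid (Matrix (Fin d) (Fin d) ℝ)} (hS : ∀ j, M j ∈ S)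
    {c : (Fin p → Fin d) → (Fin p → Fin d) → ℝ}
    (hf : ∀ X ∈ S, ν X ^ p ≤ ∑ a, ∑ b, c a b * kronPow X p a b) :
    ∃ l : Fin N → ℝ,
      (∀ s, HasGrowthRate (fun k => pathExp P M k (fun X _ => ν X ^ p) s) (l s)) ∧
      IsGreatest (Set.range l) (specRadius (transferMatrix' P M p)) := by
  set T := transferMatrix' P M p with hT
  -- Right multiplication by `w s` keeps the block column s, the part of T^k describing the chain
  -- started at s.
  let w : Fin N → Matrix (Fin N × (Fin p → Fin d)) (Fin N × (Fin p → Fin d)) ℝ :=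
    fun s => Matrix.diagonal fun x => if x.1 = s then 1 else 0
  have hTw : ∀ k s x y, (T ^ k * w s) x y = if y.1 = s then (T ^ k) x y else 0 := by
    intro k s x y
    simp [w, Matrix.mul_diagonal]
  have hw : ∑ s, w s = 1 := by
    ext x y
    simp [w, Matrix.sum_apply, Matrix.diagonal_apply, Matrix.one_apply]
  choose l hl using fun s => exists_hasGrowthRate_norm_map_pow_mul T (w s)
  have hF0 : ∀ k s, 0 ≤ pathExp P M k (fun X _ => ν X ^ p) s := fun k s =>
    pathExp_nonneg hP k (fun X _ => pow_nonneg (apply_nonneg ν X) p) s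
  refine ⟨l, fun s => ?_, ?_⟩
  · obtain ⟨C, hC0, hC⟩ := exists_abs_transferMatrix'_pow_le (M := M) hP p ν hν
    let n := Fintype.card (Fin N × (Fin p → Fin d))
    let C₁ : ℝ := n * (n * C)
    let C₂ : ℝ := ∑ _j : Fin N, ∑ a, ∑ b, |c a b|
    have hC₁ : 0 ≤ C₁ := by positivity
    have hC₂ : 0 ≤ C₂ := by positivity
    -- The summand 1 keeps the constant positive when C₁ and C₂ vanish, as for d = 0 and p > 0.
    refine (hl s).of_le_of_le (c := C₁ + C₂ + 1) (fun k => hF0 k s) (fun _ => norm_nonneg _)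
      (by positivity) (fun k => ?_) (fun k => ?_)
    · calc pathExp P M k (fun X _ => ν X ^ p) s
          ≤ ∑ j, ∑ a, ∑ b, c a b * (T ^ k) (j, a) (s, b) :=
            pathExp_le_sum_transferMatrix' hP hS hf k s
        _ ≤ ∑ _j : Fin N, ∑ a, ∑ b, |c a b| * ‖(T ^ k * w s).map (algebraMap ℝ ℂ)‖ := by
            refine Finset.sum_le_sum fun j _ => Finset.sum_le_sum fun a _ =>
              Finset.sum_le_sum fun b _ => ?_
            refine (le_abs_self _).trans ?_
            rw [abs_mul]
            have := abs_apply_le_norm_map (T ^ k * w s) (j, a) (s, b)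
            rw [hTw, if_pos rfl] at this
            gcongr
        _ = C₂ * ‖(T ^ k * w s).map (algebraMap ℝ ℂ)‖ := by
            simp only [C₂, Finset.sum_mul]
        _ ≤ _ := by
            gcongr
            linarith
    · calc ‖(T ^ k * w s).map (algebraMap ℝ ℂ)‖
          ≤ ∑ x, ∑ y, |(T ^ k * w s) x y| := norm_map_le_sum _
        _ ≤ ∑ _x : Fin N × (Fin p → Fin d), ∑ _y : Fin N × (Fin p → Fin d),
              C * pathExp P M k (fun X _ => ν X ^ p) s := by
            refine Finset.sum_le_sum fun x _ => Finset.sum_le_sum fun y _ => ?_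
            rw [hTw]
            split_ifs with h
            · subst h
              exact hC k x.1 x.2 y.1 y.2
            · rw [abs_zero]
              exact mul_nonneg hC0.le (hF0 k s)
        _ = C₁ * pathExp P M k (fun X _ => ν X ^ p) s := by
            simp only [Finset.sum_const, Finset.card_univ, nsmul_eq_mul, C₁, n]
            ring
        _ ≤ _ := by
            gcongr
            · exact hF0 k s
            · linarith
  · have hρ := hasGrowthRate_norm_map_pow T
    have hle : ∀ s, l s ≤ specRadius T := by
      intro s
      refine (hl s).le_of_le hρ (c := ‖(w s).map (algebraMap ℝ ℂ)‖ + 1) (fun _ => norm_nonneg _)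
        (fun _ => norm_nonneg _) (by positivity) fun k => ?_
      rw [Matrix.map_mul, mul_comm]
      refine (norm_mul_le _ _).trans (mul_le_mul_of_nonneg_left ?_ (norm_nonneg _))
      linarith
    have : Nonempty (Fin N) := ⟨⟨0, hN⟩⟩
    obtain ⟨s, hs⟩ := HasGrowthRate.exists_le_of_le_sum hl hρ (fun _ _ => norm_nonneg _)
      (fun _ => norm_nonneg _) (fun k => by
        calc ‖(T ^ k).map (algebraMap ℝ ℂ)‖
            = ‖∑ s, (T ^ k * w s).map (algebraMap ℝ ℂ)‖ := by
              congr 1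
              simp only [Matrix.map_mul, ← Finset.mul_sum]
              rw [show ∑ s, (w s).map (algebraMap ℝ ℂ) = (∑ s, w s).map (algebraMap ℝ ℂ) from
                (map_sum (algebraMap ℝ ℂ).mapMatrix w Finset.univ).symm, hw,
                ← Matrix.map_mul, mul_one]
          _ ≤ _ := norm_sum_le _ _)
    exact ⟨⟨s, le_antisymm (hle s) hs⟩, by rintro _ ⟨s, rfl⟩; exact hle s⟩

end

/-! ### Comparing initial states -/

section

variable {N d : ℕ} {P : Matrix (Fin N) (Fin N) ℝ} {M : Fin N → Matrix (Fin d) (Fin d) ℝ}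

/-- After the first step both chains continue identically, and P s j ≤ C · P t j for every j. -/
theorem growthRate_le_of_pos (hP : ∀ i j, 0 < P i j) {g : Matrix (Fin d) (Fin d) ℝ → ℝ}
    (hg : ∀ X, 0 ≤ g X) {l : Fin N → ℝ}
    (hl : ∀ s, HasGrowthRate (fun k => pathExp P M k (fun X _ => g X) s) (l s)) (s t : Fin N) :
    l s ≤ l t := by
  have hP0 : ∀ i j, 0 ≤ P i j := fun i j => (hP i j).le
  have hF0 : ∀ k s, 0 ≤ pathExp P M k (fun X _ => g X) s := fun k s =>
    pathExp_nonneg hP0 k (fun X _ => hg X) s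
  let C : ℝ := ∑ j, P s j / P t j
  have hterm : ∀ j, 0 < P s j / P t j := fun j => div_pos (hP s j) (hP t j)
  have hC : 0 < C := Finset.sum_pos (fun j _ => hterm j) ⟨s, Finset.mem_univ s⟩
  refine ((hl s).shift fun k => hF0 k s).le_of_le ((hl t).shift fun k => hF0 k t)
    (fun k => hF0 _ s) (fun k => hF0 _ t) hC fun k => ?_
  rw [pathExp_succ, pathExp_succ, Finset.mul_sum]
  refine Finset.sum_le_sum fun j _ => ?_
  rw [← mul_assoc]
  refine mul_le_mul_of_nonneg_right ?_ (pathExp_nonneg hP0 k (fun X _ => hg _) j)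
  rw [← div_le_iff₀ (hP t j)]
  exact Finset.single_le_sum (fun j _ => (hterm j).le) (Finset.mem_univ j)

/-- From s the chain first moves to t with positive probability, and the extra factor M_t costs at
most the constant C. -/
theorem growthRate_le_of_step (hP : ∀ i j, 0 ≤ P i j) {g : Matrix (Fin d) (Fin d) ℝ → ℝ}
    (hg : ∀ X, 0 ≤ g X) {C : ℝ} (hC : 0 < C) {l : Fin N → ℝ}
    (hl : ∀ s, HasGrowthRate (fun k => pathExp P M k (fun X _ => g X) s) (l s)) {s t : Fin N}
    (hst : 0 < P s t) (hgC : ∀ X, g X ≤ C * g (X * M t)) : l t ≤ l s := by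
  have hF0 : ∀ k s, 0 ≤ pathExp P M k (fun X _ => g X) s := fun k s =>
    pathExp_nonneg hP k (fun X _ => hg X) s
  refine (hl t).le_of_le ((hl s).shift fun k => hF0 k s) (fun k => hF0 k t) (fun k => hF0 _ s)
    (c := C / P s t) (div_pos hC hst) fun k => ?_
  have h1 : P s t * pathExp P M k (fun X _ => g (X * M t)) t ≤
      pathExp P M (k + 1) (fun X _ => g X) s := by
    rw [pathExp_succ]
    exact Finset.single_le_sum
      (f := fun j => P s j * pathExp P M k (fun X _ => g (X * M j)) j)
      (fun j _ => mul_nonneg (hP s j) (pathExp_nonneg hP k (fun X _ => hg _) j))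
      (Finset.mem_univ t)
  have h2 : pathExp P M k (fun X _ => g X) t ≤
      C * pathExp P M k (fun X _ => g (X * M t)) t := by
    rw [← pathExp_const_mul]
    exact pathExp_mono hP (S := ⊤) (fun _ => Submonoid.mem_top _) k (fun X _ _ => hgC X) t
  rw [div_mul_eq_mul_div, le_div_iff₀ hst]
  calc _ ≤ C * pathExp P M k (fun X _ => g (X * M t)) t * P s t := by gcongr
    _ = C * (P s t * pathExp P M k (fun X _ => g (X * M t)) t) := by ring
    _ ≤ _ := by gcongr

theorem le_of_pow_pos {l : Fin N → ℝ} (hP : ∀ i j, 0 ≤ P i j)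
    (hl : ∀ s t, 0 < P s t → l t ≤ l s) (n : ℕ) {s t : Fin N} (hst : 0 < (P ^ n) s t) :
    l t ≤ l s := by
  induction n generalizing s with
  | zero =>
    rcases eq_or_ne s t with rfl | h
    · exact le_rfl
    · simp [h] at hst
  | succ n ih =>
    rw [pow_succ', Matrix.mul_apply] at hst
    obtain ⟨j, _, hj⟩ := Finset.exists_lt_of_sum_lt (f := fun _ => (0 : ℝ))
      (by simpa using hst)
    have h1 : 0 < P s j := (hP s j).lt_of_ne fun h => by simp [← h] at hj
    exact (ih (pos_of_mul_pos_right hj h1.le)).trans (hl s j h1)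

/-- Right multiplication by an invertible matrix is bounded below. -/
theorem exists_seminorm_pow_le_mul (ν : Seminorm ℝ (Matrix (Fin d) (Fin d) ℝ))
    (hν : ∀ X, ν X = 0 → X = 0) (p : ℕ) {A : Matrix (Fin d) (Fin d) ℝ} (hA : IsUnit A) :
    ∃ C, 0 < C ∧ ∀ X, ν X ^ p ≤ C * ν (X * A) ^ p := by
  obtain ⟨C, hC0, hC⟩ := exists_abs_apply_le ν hν
  -- The seminorm Y ↦ ν(Y A⁻¹) is bounded by the entries of Y; it is applied at Y = XA.
  obtain ⟨D, hD0, hD⟩ := exists_seminorm_le_sum_abs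
    (ν.comp (LinearMap.mulRight ℝ (↑hA.unit⁻¹ : Matrix (Fin d) (Fin d) ℝ)))
  refine ⟨(D * (d * (d * C)) + 1) ^ p, by positivity, fun X => ?_⟩
  rw [← mul_pow]
  refine pow_le_pow_left₀ (apply_nonneg ν X) ?_ p
  have h := hD (X * A)
  rw [Seminorm.comp_apply, LinearMap.mulRight_apply, mul_assoc, hA.mul_val_inv, mul_one] at h
  have h2 : ∑ i, ∑ j, |(X * A) i j| ≤ d * (d * C) * ν (X * A) := by
    calc ∑ i, ∑ j, |(X * A) i j| ≤ ∑ _i : Fin d, ∑ _j : Fin d, C * ν (X * A) :=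
          Finset.sum_le_sum fun i _ => Finset.sum_le_sum fun j _ => hC _ i j
      _ = _ := by
          simp
          ring
  have h3 : 0 ≤ ν (X * A) := apply_nonneg ν _
  calc ν X ≤ D * (d * (d * C) * ν (X * A)) := h.trans (by gcongr)
    _ ≤ _ := by nlinarith

/-! ### Norms dominated by functionals of Kronecker powers -/

/-- The square of a norm is dominated by the square of the Frobenius norm. -/
theorem exists_seminorm_sq_le_kronPow (ν : Seminorm ℝ (Matrix (Fin d) (Fin d) ℝ)) :
    ∃ c : (Fin 2 → Fin d) → (Fin 2 → Fin d) → ℝ,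
      ∀ X, ν X ^ 2 ≤ ∑ a, ∑ b, c a b * kronPow X 2 a b := by
  obtain ⟨C, hC0, hC⟩ := exists_seminorm_le_sum_abs ν
  -- The entries of X ⊗ X at a = (i, i), b = (j, j) are X_ij²; the factor d·d comes from
  -- Cauchy–Schwarz over the d² entries.
  refine ⟨fun a b => if a 0 = a 1 ∧ b 0 = b 1 then C ^ 2 * (d * d) else 0, fun X => ?_⟩
  have h1 : ∑ a : Fin 2 → Fin d, ∑ b : Fin 2 → Fin d,
      (if a 0 = a 1 ∧ b 0 = b 1 then C ^ 2 * (d * d) else 0) * kronPow X 2 a b =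
      C ^ 2 * (d * d) * ∑ i, ∑ j, X i j ^ 2 := by
    rw [← (finTwoArrowEquiv (Fin d)).symm.sum_comp, Fintype.sum_prod_type, Finset.mul_sum]
    refine Finset.sum_congr rfl fun i _ => ?_
    rw [Finset.sum_eq_single i]
    · rw [← (finTwoArrowEquiv (Fin d)).symm.sum_comp, Fintype.sum_prod_type, Finset.mul_sum]
      refine Finset.sum_congr rfl fun j _ => ?_
      rw [Finset.sum_eq_single j]
      · simp [kronPow, Fin.prod_univ_two, finTwoArrowEquiv, sq]
      · intro b _ hb
        simp [finTwoArrowEquiv, hb.symm]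
      · simp
    · intro b _ hb
      simp [finTwoArrowEquiv, hb.symm]
    · simp
  rw [h1]
  have h2 : (∑ i, ∑ j, |X i j|) ^ 2 ≤ d * d * ∑ i, ∑ j, X i j ^ 2 := by
    have := sq_sum_le_card_mul_sum_sq (s := (Finset.univ : Finset (Fin d × Fin d)))
      (f := fun q => |X q.1 q.2|)
    simpa [Fintype.sum_prod_type] using this
  calc ν X ^ 2 ≤ (C * ∑ i, ∑ j, |X i j|) ^ 2 := pow_le_pow_left₀ (apply_nonneg ν X) (hC X) 2
    _ = C ^ 2 * (∑ i, ∑ j, |X i j|) ^ 2 := mul_pow _ _ _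
    _ ≤ C ^ 2 * (d * d * ∑ i, ∑ j, X i j ^ 2) := by gcongr
    _ = _ := by ring

/-- The matrices that leave a set invariant. -/
def invariantSubmonoid (K : Set (Fin d → ℝ)) : Submonoid (Matrix (Fin d) (Fin d) ℝ) where
  carrier := {X | LeavesInvariant X K}
  one_mem' x hx := by rwa [Matrix.one_mulVec]
  mul_mem' {X Y} hX hY x hx := by
    rw [← Matrix.mulVec_mulVec]
    exact hX _ (hY x hx)

/-- For cone-preserving matrices one linear functional bounds every |X i j|, so summing the d²
entries bounds the norm. -/
theorem IsProperCone.exists_seminorm_le_kronPow {K : Set (Fin d → ℝ)} (hK : IsProperCone K)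
    (ν : Seminorm ℝ (Matrix (Fin d) (Fin d) ℝ)) :
    ∃ c : (Fin 1 → Fin d) → (Fin 1 → Fin d) → ℝ,
      ∀ X ∈ invariantSubmonoid K, ν X ^ 1 ≤ ∑ a, ∑ b, c a b * kronPow X 1 a b := by
  obtain ⟨C, hC0, hC⟩ := exists_seminorm_le_sum_abs ν
  obtain ⟨u, v, huv⟩ := hK.exists_abs_apply_le
  refine ⟨fun a b => C * (d * d) * (u (a 0) * v (b 0)), fun X hX => ?_⟩
  have h1 : ∑ a : Fin 1 → Fin d, ∑ b : Fin 1 → Fin d,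
      C * (d * d) * (u (a 0) * v (b 0)) * kronPow X 1 a b =
      C * (d * d) * ∑ i, ∑ j, u i * v j * X i j := by
    simp only [kronPow_one_apply, mul_assoc, ← Finset.mul_sum]
    rw [← (Equiv.funUnique (Fin 1) (Fin d)).symm.sum_comp]
    congr 3
    refine Finset.sum_congr rfl fun i _ => ?_
    rw [← (Equiv.funUnique (Fin 1) (Fin d)).symm.sum_comp]
    simp
  rw [h1, pow_one]
  calc ν X ≤ C * ∑ i, ∑ j, |X i j| := hC X
    _ ≤ C * ∑ _i : Fin d, ∑ _j : Fin d, ∑ a, ∑ b, u a * v b * X a b := by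
        gcongr with i _ j _
        exact huv X hX i j
    _ = _ := by
        simp
        ring

/-! ### From growth rates to p-radii -/

/-- The `p`-radius in terms of the growth rate of the expectations. -/
theorem IsMarkovChain.tendsto_pRadiusSeq {s₀ : Fin N} {Ω : Type*} [MeasurableSpace Ω]
    {μ : Measure Ω} [IsProbabilityMeasure μ] {σ : ℕ → Ω → Fin N}
    (hσ : IsMarkovChain P s₀ μ σ) (hP : ∀ i j, 0 ≤ P i j) {p : ℕ} (hp : 0 < p)
    (ν : Seminorm ℝ (Matrix (Fin d) (Fin d) ℝ)) {l : ℝ}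
    (hl : HasGrowthRate (fun k => pathExp P M k (fun X _ => ν X ^ p) s₀) l) :
    Tendsto (pRadiusSeq ν p μ (fun k ω => M (σ k ω))) atTop (𝓝 (l ^ (1 / (p : ℝ)))) := by
  have h := hl.rpow_const (p := 1 / (p : ℝ)) (Or.inr (by positivity))
  refine h.congr fun k => ?_
  rw [pRadiusSeq, hσ.integral_revProd M k (fun X _ => ν X ^ p), ← Real.rpow_mul
    (pathExp_nonneg hP k (fun X _ => pow_nonneg (apply_nonneg ν X) p) s₀)]
  congr 1
  rw [one_div_mul_one_div, mul_comm]

end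

end MarkovSwitched

theorem mainTheorem7 {N d : ℕ} (hN : 0 < N)
    (P : Matrix (Fin N) (Fin N) ℝ)
    (hP_nonneg : ∀ i j, 0 ≤ P i j) (hP_sum : ∀ i, ∑ j, P i j = 1)
    (M : Fin N → Matrix (Fin d) (Fin d) ℝ)
    (p : ℕ)
    (hp : p = 2 ∨
      (p = 1 ∧ ∃ K : Set (Fin d → ℝ), MarkovSwitched.IsProperCone K ∧
        ∀ i, MarkovSwitched.LeavesInvariant (M i) K))
    -- an arbitrary norm on the space of matrices
    (ν : Seminorm ℝ (Matrix (Fin d) (Fin d) ℝ)) (hν : ∀ X, ν X = 0 → X = 0)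
    -- for each initial state, a realization of the Markov chain started there
    (Ω : Fin N → Type*) [∀ s₀, MeasurableSpace (Ω s₀)]
    (μ : ∀ s₀, Measure (Ω s₀)) [∀ s₀, IsProbabilityMeasure (μ s₀)]
    (σ : ∀ s₀, ℕ → Ω s₀ → Fin N)
    (hσ : ∀ s₀, MarkovSwitched.IsMarkovChain P s₀ (μ s₀) (σ s₀)) :
    -- the limit defining the `p`-radius exists for every initial state
    (∀ s₀, Tendsto (MarkovSwitched.pRadiusSeq ν p (μ s₀) (fun k ω => M (σ s₀ k ω))) atTop
      (𝓝 (MarkovSwitched.pRadius ν p (μ s₀) (fun k ω => M (σ s₀ k ω))))) ∧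
    -- its maximum over the initial states
    IsGreatest
      (Set.range fun s₀ => MarkovSwitched.pRadius ν p (μ s₀) (fun k ω => M (σ s₀ k ω)))
      (MarkovSwitched.specRadius (MarkovSwitched.transferMatrix P M p) ^ (1 / (p : ℝ))) ∧
    -- its value for each initial state, when the choice of that state is immaterial
    ((∀ i j, 0 < P i j) ∨ ((∀ i j, ∃ n : ℕ, 0 < (P ^ n) i j) ∧ ∀ i, IsUnit (M i)) →
      ∀ s₀, MarkovSwitched.pRadius ν p (μ s₀) (fun k ω => M (σ s₀ k ω)) =
        MarkovSwitched.specRadius (MarkovSwitched.transferMatrix P M p) ^ (1 / (p : ℝ))) := by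
  have hp0 : 0 < p := by
    rcases hp with rfl | ⟨rfl, _⟩ <;> norm_num
  obtain ⟨l, hl, hmax⟩ : ∃ l : Fin N → ℝ,
      (∀ s, MarkovSwitched.HasGrowthRate
        (fun k => MarkovSwitched.pathExp P M k (fun X _ => ν X ^ p) s) (l s)) ∧
      IsGreatest (Set.range l)
        (MarkovSwitched.specRadius (MarkovSwitched.transferMatrix P M p)) := by
    rw [MarkovSwitched.specRadius_transferMatrix]
    rcases hp with rfl | ⟨rfl, K, hK, hMK⟩
    · obtain ⟨c, hc⟩ := MarkovSwitched.exists_seminorm_sq_le_kronPow ν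
      exact MarkovSwitched.exists_hasGrowthRate_pathExp hN hP_nonneg ν hν (S := ⊤)
        (fun _ => Submonoid.mem_top _) (fun X _ => hc X)
    · obtain ⟨c, hc⟩ := hK.exists_seminorm_le_kronPow ν
      exact MarkovSwitched.exists_hasGrowthRate_pathExp hN hP_nonneg ν hν
        (S := MarkovSwitched.invariantSubmonoid K) hMK hc
  have hg0 : ∀ X, 0 ≤ ν X ^ p := fun X => pow_nonneg (apply_nonneg ν X) p
  have hl0 : ∀ s, 0 ≤ l s := fun s => (hl s).nonneg fun k =>
    MarkovSwitched.pathExp_nonneg hP_nonneg k (fun X _ => hg0 X) s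
  have hlim : ∀ s₀, Tendsto (MarkovSwitched.pRadiusSeq ν p (μ s₀) (fun k ω => M (σ s₀ k ω))) atTop
      (𝓝 (l s₀ ^ (1 / (p : ℝ)))) := fun s₀ =>
    (hσ s₀).tendsto_pRadiusSeq hP_nonneg hp0 ν (hl s₀)
  have hrad : ∀ s₀, MarkovSwitched.pRadius ν p (μ s₀) (fun k ω => M (σ s₀ k ω)) =
      l s₀ ^ (1 / (p : ℝ)) := fun s₀ => (hlim s₀).limUnder_eq
  simp only [hrad]
  obtain ⟨s, hs⟩ := hmax.1
  refine ⟨hlim, ⟨⟨s, by simp only [hs]⟩, ?_⟩, fun h s₀ => ?_⟩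
  · rintro _ ⟨t, rfl⟩
    exact Real.rpow_le_rpow (hl0 t) (hmax.2 ⟨t, rfl⟩) (by positivity)
  · rw [← hs]
    congr 1
    -- The state s attains the largest rate, so only l s ≤ l s₀ remains. In the irreducible case a
    -- path from s₀ to s transports the bound edge by edge.
    refine le_antisymm (hs ▸ hmax.2 ⟨s₀, rfl⟩) ?_
    rcases h with h | ⟨hirr, hM⟩
    · exact MarkovSwitched.growthRate_le_of_pos h hg0 hl s s₀
    · obtain ⟨n, hn⟩ := hirr s₀ s
      refine MarkovSwitched.le_of_pow_pos hP_nonneg (fun i j hij => ?_) n hn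
      obtain ⟨C, hC0, hC⟩ := MarkovSwitched.exists_seminorm_pow_le_mul ν hν p (hM j)
      exact MarkovSwitched.growthRate_le_of_step hP_nonneg hg0 hC0 hl hij hC
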